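/- Let $n\in\mathbb N$ and, for $1\le i,j\le n$, let $\mathcal C_{ij}=\{\sum_{l=0}^{d_{ij}} q_l s^l:\ q_l\in[\underline q_l(ij),\overline q_l(ij)]\}$ be a real interval polynomial, where $d_{ij}\ge 0$ is an integer and $\underline q_l(ij)\le\overline q_l(ij)$ are real numbers. The four Kharitonov polynomials of $\mathcal C_{ij}$ are (writing $\underline q_l,\overline q_l$ for $\underline q_l(ij),\overline q_l(ij)$, and repeating each pattern of lower and upper bounds with period 4 up to degree $d_{ij}$) $$c^1_{ij}=\underline q_0+\underline q_1 s+\overline q_2 s^2+\overline q_3 s^3+\cdots,\qquad c^2_{ij}=\underline q_0+\overline q_1 s+\overline q_2 s^2+\underline q_3 s^3+\cdots,$$ $$c^3_{ij}=\overline q_0+\underline q_1 s+\underline q_2 s^2+\overline q_3 s^3+\cdots,\qquad c^4_{ij}=\overline q_0+\overline q_1 s+\underline q_2 s^2+\underline q_3 s^3+\cdots.$$ Let $K_{ij}=\{c^1_{ij},c^2_{ij},c^3_{ij},c^4_{ij}\}$ be the set of Kharitonov vertices, and let $E_{ij}=\{\lambda c^r_{ij}+(1-\lambda)c^t_{ij}:\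 \lambda\in[0,1],\ (r,t)\in\{(1,2),(2,4),(4,3),(3,1)\}\}$ be the set of Kharitonov edges. Let $\mathcal G$ be the set of all $n\times n$ polynomial matrices $(c_{ij}(s))$ with $c_{ij}\in\mathcal C_{ij}$ for all $i,j$, and let $$\mathcal G_E=\bigcup_{\sigma\in S_n}\{(c_{ij}(s)):\ c_{ij}\in E_{ij}\text{ if } i=\sigma(j),\ c_{ij}\in K_{ij}\text{ if } i\ne\sigma(j)\},$$ where $S_n$ is the set of all permutations of $\{1,\dots,n\}$. Call a set of polynomial matrices robustly Hurwitz stable if, for every matrix in the set, all complex roots of its determinant lie in the open left half-plane $\{z:\operatorname{Re} z<0\}$ (if the determinant is the zero polynomial, every complex number counts as a root). Then $\mathcal G$ is robustly Hurwitz stable if and only if $\mathcal G_E$ is robustly Hurwitz stable. -/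

import Mathlib

open Polynomial

noncomputable section

/-- A polynomial matrix is `D`-stable if all complex roots of its determinant lie in `D`.
(If the determinant is the zero polynomial, every complex number is a root.) -/
def IsDStable {n : ℕ} (D : Set ℂ) (M : Matrix (Fin n) (Fin n) ℝ[X]) : Prop :=
  ∀ z : ℂ, aeval z M.det = 0 → z ∈ D

/-- A set of polynomial matrices is robustly `D`-stable if each of its members is `D`-stable. -/
def RobustlyDStable {n : ℕ} (D : Set ℂ) (F : Set (Matrix (Fin n) (Fin n) ℝ[X])) : Prop :=
  ∀ M ∈ F, IsDStable D M

/-- The open left half plane. -/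
def openLeftHalfPlane : Set ℂ := {z | z.re < 0}

/-- Robust Hurwitz stability is robust `D`-stability for the open left half plane. -/
def RobustlyHurwitzStable {n : ℕ} (F : Set (Matrix (Fin n) (Fin n) ℝ[X])) : Prop :=
  RobustlyDStable openLeftHalfPlane F

/-- The polynomial `q 0 + q 1 s + ... + q d s ^ d`. -/
def polyOfCoeffs (d : ℕ) (q : ℕ → ℝ) : ℝ[X] :=
  ∑ l ∈ Finset.range (d + 1), C (q l) * X ^ l

/-- The interval polynomial with coefficient intervals `[lo l, hi l]`, `l = 0, ..., d`. -/
def intervalPoly (d : ℕ) (lo hi : ℕ → ℝ) : Set ℝ[X] :=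
  {p | ∃ q : ℕ → ℝ, (∀ l ≤ d, q l ∈ Set.Icc (lo l) (hi l)) ∧ p = polyOfCoeffs d q}

/-- First Kharitonov polynomial: coefficients low, low, high, high, repeated periodically. -/
def kharitonov1 (d : ℕ) (lo hi : ℕ → ℝ) : ℝ[X] :=
  polyOfCoeffs d fun l => if l % 4 = 0 ∨ l % 4 = 1 then lo l else hi l

/-- Second Kharitonov polynomial: low, high, high, low. -/
def kharitonov2 (d : ℕ) (lo hi : ℕ → ℝ) : ℝ[X] :=
  polyOfCoeffs d fun l => if l % 4 = 0 ∨ l % 4 = 3 then lo l else hi l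

/-- Third Kharitonov polynomial: high, low, low, high. -/
def kharitonov3 (d : ℕ) (lo hi : ℕ → ℝ) : ℝ[X] :=
  polyOfCoeffs d fun l => if l % 4 = 1 ∨ l % 4 = 2 then lo l else hi l

/-- Fourth Kharitonov polynomial: high, high, low, low. -/
def kharitonov4 (d : ℕ) (lo hi : ℕ → ℝ) : ℝ[X] :=
  polyOfCoeffs d fun l => if l % 4 = 2 ∨ l % 4 = 3 then lo l else hi l

/-- The Kharitonov vertex set of an interval polynomial. -/
def kharitonovVertices (d : ℕ) (lo hi : ℕ → ℝ) : Set ℝ[X] :=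
  {kharitonov1 d lo hi, kharitonov2 d lo hi, kharitonov3 d lo hi, kharitonov4 d lo hi}

/-- The segment `{λ f + (1 - λ) g : λ ∈ [0, 1]}` of polynomials. -/
def polySegment (f g : ℝ[X]) : Set ℝ[X] :=
  {p | ∃ t ∈ Set.Icc (0 : ℝ) 1, p = C t * f + C (1 - t) * g}

/-- The Kharitonov edge set of an interval polynomial: the union of the segments between the
Kharitonov polynomials with index pairs `(1,2)`, `(2,4)`, `(4,3)`, `(3,1)`. -/
def kharitonovEdges (d : ℕ) (lo hi : ℕ → ℝ) : Set ℝ[X] :=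
  polySegment (kharitonov1 d lo hi) (kharitonov2 d lo hi) ∪
  polySegment (kharitonov2 d lo hi) (kharitonov4 d lo hi) ∪
  polySegment (kharitonov4 d lo hi) (kharitonov3 d lo hi) ∪
  polySegment (kharitonov3 d lo hi) (kharitonov1 d lo hi)

/-- The family of polynomial matrices whose `(i, j)` entry ranges over the interval polynomial
with degree bound `d i j` and coefficient intervals `[lo i j l, hi i j l]`. -/
def intervalMatrixFamily {n : ℕ} (d : Fin n → Fin n → ℕ) (lo hi : Fin n → Fin n → ℕ → ℝ) :
    Set (Matrix (Fin n) (Fin n) ℝ[X]) :=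
  {M | ∀ i j, M i j ∈ intervalPoly (d i j) (lo i j) (hi i j)}

/-- The subfamily of matrices such that, for some permutation `σ`, the `(i, j)` entry is in the
Kharitonov edge set if `i = σ j` and in the Kharitonov vertex set otherwise. -/
def kharitonovEdgeFamily {n : ℕ} (d : Fin n → Fin n → ℕ) (lo hi : Fin n → Fin n → ℕ → ℝ) :
    Set (Matrix (Fin n) (Fin n) ℝ[X]) :=
  ⋃ σ : Equiv.Perm (Fin n),
    {M | ∀ i j,
      (i = σ j → M i j ∈ kharitonovEdges (d i j) (lo i j) (hi i j)) ∧
      (i ≠ σ j → M i j ∈ kharitonovVertices (d i j) (lo i j) (hi i j))}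

end

/-! At a point `iω` of the imaginary axis an interval polynomial takes its values in a rectangle
whose corners are the values of the four Kharitonov polynomials. One parameter `t` moves the real
part (even coefficients), another, `u`, the imaginary part (odd coefficients). A determinant is
jointly affine in two parameters that sit in one row or one column, possibly in the same entry, so
varying them sweeps out a parallelogram of polynomials. The heart is an edge theorem
(`IsHurwitz.parallelogram`): such a parallelogram is Hurwitz once its edges are. At `ω = 0` all
values are real, so the parallelogram is degenerate there; as `ω` varies, the origin cannot enter it
without crossing an edge. Zero exclusion on the axis then gives stability
(`IsHurwitz.of_mem_parallelogram`). Applied repeatedly, this pushes parameters to end points until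
each row and each column has at most one free parameter (`isHurwitz_det_paramMatrix`). The free
positions form a partial injection, which extends to a permutation: this is the edge family.
Finally, Kharitonov rectangles are replaced by full interval polynomials one entry at a time
(`isHurwitz_det_of_forall_kharitonovParam`). -/

/-! ### Root-product estimates for Hurwitz polynomials. -/

/-- A real polynomial is Hurwitz if all its complex roots have negative real part. -/
def IsHurwitz (p : ℝ[X]) : Prop := ∀ z : ℂ, aeval z p = 0 → z.re < 0

lemma IsHurwitz.ne_zero {p : ℝ[X]} (hp : IsHurwitz p) : p ≠ 0 := by
  rintro rfl
  simpa using hp 0 (by simp)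

lemma IsHurwitz.aeval_ne_zero {p : ℝ[X]} (hp : IsHurwitz p) {z : ℂ} (hz : 0 ≤ z.re) :
    aeval z p ≠ 0 := fun h => (hp z h).not_ge hz

lemma aeval_eq_leadingCoeff_mul_prod (p : ℝ[X]) (z : ℂ) :
    aeval z p = (p.leadingCoeff : ℂ) * ((p.aroots ℂ).map (fun r => z - r)).prod := by
  simpa using (IsAlgClosed.splits (p.map (algebraMap ℝ ℂ))).aeval_eq_prod_aroots z

lemma IsHurwitz.re_neg_of_mem_aroots {p : ℝ[X]} (hp : IsHurwitz p) {r : ℂ}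
    (hr : r ∈ p.aroots ℂ) : r.re < 0 :=
  hp r (mem_aroots.1 hr).2

/-- A Hurwitz polynomial decreases in modulus along the projection of the closed right half plane
to the imaginary axis. -/
lemma IsHurwitz.norm_aeval_im_le {p : ℝ[X]} (hp : IsHurwitz p) {z : ℂ} (hz : 0 ≤ z.re) :
    ‖aeval (z.im * Complex.I) p‖ ≤ ‖aeval z p‖ := by
  -- Factor by factor: every root lies to the left of the axis, so projecting `z` onto the axis
  -- shortens its distance to each root.
  have key : ∀ m : Multiset ℂ, (∀ r ∈ m, r.re < 0) →
      ‖(m.map (fun r => z.im * Complex.I - r)).prod‖ ≤ ‖(m.map (fun r => z - r)).prod‖ := by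
    intro m
    induction m using Multiset.induction with
    | empty => simp
    | cons a m ih =>
      intro h
      have ha := h a (by simp)
      have := ih fun r hr => h r (by simp [hr])
      simp only [Multiset.map_cons, Multiset.prod_cons, norm_mul]
      gcongr
      rw [← sq_le_sq₀ (norm_nonneg _) (norm_nonneg _), Complex.sq_norm, Complex.sq_norm,
        Complex.normSq_apply, Complex.normSq_apply]
      simp
      nlinarith
  rw [aeval_eq_leadingCoeff_mul_prod p, aeval_eq_leadingCoeff_mul_prod p, norm_mul, norm_mul]
  gcongr
  exact key _ fun r hr => hp.re_neg_of_mem_aroots hr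

/-- A Hurwitz polynomial of degree `N` grows like `(1 + ‖z‖) ^ N` on the closed right half
plane. -/
lemma IsHurwitz.exists_mul_pow_le_norm {p : ℝ[X]} (hp : IsHurwitz p) :
    ∃ c > 0, ∀ z : ℂ, 0 ≤ z.re → c * (1 + ‖z‖) ^ p.natDegree ≤ ‖aeval z p‖ := by
  have key : ∀ m : Multiset ℂ, (∀ r ∈ m, r.re < 0) → ∃ c > 0, ∀ z : ℂ, 0 ≤ z.re →
      c * (1 + ‖z‖) ^ m.card ≤ ‖(m.map (fun r => z - r)).prod‖ := by
    intro m
    induction m using Multiset.induction with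
    | empty => exact fun _ => ⟨1, one_pos, by simp⟩
    | cons a m ih =>
      intro h
      have ha := h a (by simp)
      obtain ⟨c, hc, hm⟩ := ih fun r hr => h r (by simp [hr])
      -- `δ` combines the bounds `-a.re ≤ ‖z - a‖` and `‖z‖ ≤ ‖z - a‖ + ‖a‖` into `δ * (1 + ‖z‖) ≤
      -- ‖z - a‖`.
      set δ : ℝ := (-a.re) / (-a.re + (1 + ‖a‖)) with hδ
      have hden : 0 < -a.re + (1 + ‖a‖) := by positivity [neg_pos.2 ha]
      have hδ0 : 0 < δ := div_pos (neg_pos.2 ha) hden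
      refine ⟨δ * c, by positivity, fun z hz => ?_⟩
      simp only [Multiset.map_cons, Multiset.prod_cons, norm_mul, Multiset.card_cons, pow_succ]
      have h1 : δ * (1 + ‖z‖) ≤ ‖z - a‖ := by
        have e1 : -a.re ≤ ‖z - a‖ := by
          have := Complex.re_le_norm (z - a)
          simp at this
          linarith
        have e2 : ‖z‖ ≤ ‖z - a‖ + ‖a‖ := by simpa using norm_add_le (z - a) a
        rw [hδ, div_mul_eq_mul_div, div_le_iff₀ hden]
        nlinarith [norm_nonneg a]
      calc δ * c * ((1 + ‖z‖) ^ m.card * (1 + ‖z‖))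
          = (δ * (1 + ‖z‖)) * (c * (1 + ‖z‖) ^ m.card) := by ring
        _ ≤ _ := by gcongr; exact hm z hz
  obtain ⟨c, hc, h⟩ := key (p.aroots ℂ) fun r hr => hp.re_neg_of_mem_aroots hr
  have hcard : (p.aroots ℂ).card = p.natDegree := by
    simpa [aroots_def] using
      (IsAlgClosed.splits (p.map (algebraMap ℝ ℂ))).natDegree_eq_card_roots.symm
  have hl : 0 < ‖(p.leadingCoeff : ℂ)‖ := by simpa using hp.ne_zero
  refine ⟨‖(p.leadingCoeff : ℂ)‖ * c, by positivity, fun z hz => ?_⟩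
  rw [aeval_eq_leadingCoeff_mul_prod p, norm_mul, mul_assoc, ← hcard]
  gcongr
  exact h z hz

lemma exists_norm_aeval_le {p : ℝ[X]} {N : ℕ} (hp : p.natDegree ≤ N) :
    ∃ B ≥ 0, ∀ z : ℂ, ‖aeval z p‖ ≤ B * (1 + ‖z‖) ^ N := by
  refine ⟨∑ l ∈ Finset.range (N + 1), ‖p.coeff l‖, by positivity, fun z => ?_⟩
  rw [aeval_eq_sum_range' (Nat.lt_succ_of_le hp), Finset.sum_mul]
  refine norm_sum_le_of_le _ fun l hl => ?_
  rw [norm_smul, norm_pow]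
  gcongr
  calc ‖z‖ ^ l ≤ (1 + ‖z‖) ^ l := by gcongr; linarith
    _ ≤ (1 + ‖z‖) ^ N := pow_le_pow_right₀ (by linarith [norm_nonneg z])
      (Nat.lt_succ_iff.1 (Finset.mem_range.1 hl))

/-! ### Zero exclusion along a segment. -/

/-- The Hurwitz property is preserved along a segment of polynomials that do not vanish on the
imaginary axis and have constant degree up to, possibly, the end point. -/
lemma IsHurwitz.of_segment {p q : ℝ[X]} (hp : IsHurwitz p) {N : ℕ} (hpN : p.natDegree ≤ N)
    (hqN : q.natDegree ≤ N)
    (hc : ∀ s ∈ Set.Ico (0 : ℝ) 1, (1 - s) * p.coeff N + s * q.coeff N ≠ 0)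
    (hax : ∀ s ∈ Set.Icc (0 : ℝ) 1, ∀ ω : ℝ,
      (1 - s : ℂ) * aeval (ω * Complex.I) p + s * aeval (ω * Complex.I) q ≠ 0) :
    IsHurwitz q := by
  set f : ℝ → ℝ[X] := fun s => C (1 - s) * p + C s * q with hf
  have hfe : ∀ s z, aeval z (f s) = (1 - s : ℂ) * aeval z p + s * aeval z q := by
    intro s z; simp [hf]
  have hcont : ∀ z : ℂ, Continuous fun s => ‖aeval z (f s)‖ := by
    intro z; simp only [hfe]; fun_prop
  have hS : Set.Icc (0 : ℝ) 1 ⊆ {s | IsHurwitz (f s)} := by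
    apply IsClosed.Icc_subset_of_forall_mem_nhdsWithin
    -- With no zeros on the axis, being Hurwitz is equivalent to the projection inequality at every
    -- `z`, a closed condition on `s`. This argument ignores the degree, so the degree may drop at
    -- `s = 1`.
    · have : {s | IsHurwitz (f s)} ∩ Set.Icc (0 : ℝ) 1 = Set.Icc (0 : ℝ) 1 ∩
          ⋂ z ∈ {z : ℂ | 0 ≤ z.re}, {s | ‖aeval (z.im * Complex.I) (f s)‖ ≤ ‖aeval z (f s)‖} := by
        ext s
        simp only [Set.mem_inter_iff, Set.mem_iInter, Set.mem_ofPred_eq]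
        constructor
        · exact fun h => ⟨h.2, fun z hz => h.1.norm_aeval_im_le hz⟩
        · refine fun h => ⟨fun z hz => ?_, h.1⟩
          by_contra! hre
          have := h.2 z hre
          rw [hz, norm_zero, norm_le_zero_iff, hfe] at this
          exact hax s h.1 _ this
      rw [this]
      exact isClosed_Icc.inter (isClosed_biInter fun z _ => isClosed_le (hcont _) (hcont _))
    · simpa [hf] using hp
    · rintro x ⟨hx, hx01⟩
      -- Openness to the right: full degree `N` at `x` gives a lower bound of order `(1 + ‖z‖) ^ N`,
      -- which absorbs the perturbation uniformly in the unbounded half plane.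
      have hdeg : (f x).natDegree = N := by
        apply natDegree_eq_of_le_of_coeff_ne_zero
        · exact (natDegree_add_le _ _).trans (max_le ((natDegree_C_mul_le _ _).trans hpN)
            ((natDegree_C_mul_le _ _).trans hqN))
        · simpa only [hf, coeff_add, coeff_C_mul] using hc x hx01
      obtain ⟨c, hc0, hcz⟩ := IsHurwitz.exists_mul_pow_le_norm hx
      obtain ⟨B, hB0, hB⟩ := exists_norm_aeval_le (p := q - p) (N := N)
        ((natDegree_sub_le _ _).trans (max_le hqN hpN))
      have hev : ∀ᶠ s in nhds x, |s - x| * B < c := by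
        have : Filter.Tendsto (fun s => |s - x| * B) (nhds x) (nhds (|x - x| * B)) := by
          apply Continuous.tendsto; fun_prop
        simp only [sub_self, abs_zero, zero_mul] at this
        exact this.eventually_lt_const hc0
      refine nhdsWithin_le_nhds ?_
      filter_upwards [hev] with s hs z hz
      by_contra! hre
      have h1 := hcz z hre
      have h2 : aeval z (f x) = ((x - s : ℝ) : ℂ) * aeval z (q - p) := by
        have : aeval z (f x) = aeval z (f x) - aeval z (f s) := by rw [hz, sub_zero]
        rw [this, hfe, hfe]
        push_cast [map_sub]
        ring
      rw [hdeg, h2, norm_mul, Complex.norm_real, Real.norm_eq_abs, abs_sub_comm] at h1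
      have h3 := mul_le_mul_of_nonneg_left (hB z) (abs_nonneg (s - x))
      have h4 : 0 < (1 + ‖z‖) ^ N := by positivity
      nlinarith
  have := hS (Set.right_mem_Icc.2 zero_le_one)
  simpa [hf] using this

/-! ### Signs of coefficients, and zero exclusion for parallelograms. -/

/-- The leading and the constant coefficient of a real Hurwitz polynomial have the same sign. -/
lemma IsHurwitz.leadingCoeff_mul_coeff_zero_pos {p : ℝ[X]} (hp : IsHurwitz p) :
    0 < p.leadingCoeff * p.coeff 0 := by
  have hroot : ∀ x : ℝ, 0 ≤ x → p.eval x ≠ 0 := by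
    intro x hx h
    have : aeval (x : ℂ) p = ((p.eval x : ℝ) : ℂ) := by
      simpa using aeval_algebraMap_apply ℂ x p
    exact hp.aeval_ne_zero (z := x) (by simpa using hx) (by rw [this, h]; simp)
  have key : ∀ q : ℝ[X], (∀ x : ℝ, 0 ≤ x → q.eval x ≠ 0) → 0 < q.leadingCoeff →
      0 < q.coeff 0 := by
    intro q hq hl
    by_contra! h0
    rw [coeff_zero_eq_eval_zero] at h0
    have h0' := lt_of_le_of_ne h0 (hq 0 le_rfl)
    rcases le_or_gt q.degree 0 with hd | hd
    · rw [eq_C_of_degree_le_zero hd] at hl h0'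
      simp at hl h0'
      linarith
    · have ht := q.tendsto_atTop_of_leadingCoeff_nonneg hd hl.le
      obtain ⟨y, hy0, hy⟩ := ((Filter.eventually_ge_atTop (0 : ℝ)).and
        (ht.eventually_ge_atTop 0)).exists
      obtain ⟨x, hx, hx0⟩ := intermediate_value_Icc hy0 q.continuous.continuousOn ⟨h0, hy⟩
      exact hq x hx.1 hx0
  rcases lt_or_gt_of_ne (leadingCoeff_ne_zero.2 hp.ne_zero) with h | h
  · have := key (-p) (fun x hx => by simpa using hroot x hx) (by simpa using h)
    rw [coeff_neg] at this
    nlinarith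
  · exact mul_pos h (key p hroot h)

/-- For polynomials of degree at most `D`, the value at the inverse point multiplied by the
`D`-th power of the point is the value of the reflected polynomial. -/
lemma aeval_inv_reflect_mul_pow {p : ℝ[X]} {D : ℕ} (hp : p.natDegree ≤ D) {z : ℂ} (hz : z ≠ 0) :
    aeval z⁻¹ (reflect D p) * z ^ D = aeval z p := by
  let _ := invertibleOfNonzero hz
  simpa [aeval_def] using eval₂_reflect_mul_pow (algebraMap ℝ ℂ) z D p hp

/-- If on the imaginary axis `q` takes its values in the parallelogram spanned by the values of
`a`, `b`, `c`, then a sign condition on the coefficient of order `D` at the four corners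
passes to `q`. -/
lemma coeff_nonneg_of_mem_parallelogram {a b c q : ℝ[X]} {D : ℕ} (ha : a.natDegree ≤ D)
    (hb : b.natDegree ≤ D) (hc : c.natDegree ≤ D) (hq : q.natDegree ≤ D)
    (hmem : ∀ ω : ℝ, ∃ t ∈ Set.Icc (0 : ℝ) 1, ∃ u ∈ Set.Icc (0 : ℝ) 1,
      aeval (ω * Complex.I) q = aeval (ω * Complex.I) a + t * aeval (ω * Complex.I) b +
        u * aeval (ω * Complex.I) c)
    (ε : ℝ) (h00 : 0 ≤ ε * a.coeff D) (h10 : 0 ≤ ε * (a.coeff D + b.coeff D))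
    (h01 : 0 ≤ ε * (a.coeff D + c.coeff D))
    (h11 : 0 ≤ ε * (a.coeff D + b.coeff D + c.coeff D)) : 0 ≤ ε * q.coeff D := by
  -- For `ω ≠ 0` and degree at most `D`, `r p ω` is `ε` times the real part of `p(iω) / (iω) ^ D`;
  -- it tends to `ε * p.coeff D`.
  set r : ℝ[X] → ℝ → ℝ := fun p ω => ε * (aeval (ω * Complex.I)⁻¹ (reflect D p)).re with hr
  have hlim : ∀ p, Filter.Tendsto (r p) Filter.atTop (nhds (ε * p.coeff D)) := by
    intro p
    have h1 : Filter.Tendsto (fun ω : ℝ => ((ω : ℂ) * Complex.I)⁻¹) Filter.atTop (nhds 0) := by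
      rw [tendsto_zero_iff_norm_tendsto_zero]
      simpa [Function.comp_def] using
        tendsto_inv_atTop_zero.comp (Filter.tendsto_abs_atTop_atTop (G := ℝ))
    have h2 : Continuous fun z : ℂ => ε * (aeval z (reflect D p)).re := by fun_prop
    have h3 := (h2.tendsto 0).comp h1
    have h4 : aeval (0 : ℂ) (reflect D p) = p.coeff D := by
      rw [aeval_def, eval₂_at_zero, coeff_reflect]
      simp
    simpa [h4, hr] using! h3
  have hlow : ∀ᶠ ω in Filter.atTop, min (min (r a ω) (r a ω + r b ω))
      (min (r a ω + r c ω) (r a ω + r b ω + r c ω)) ≤ r q ω := by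
    filter_upwards [Filter.eventually_gt_atTop 0] with ω hω
    have hz : (ω : ℂ) * Complex.I ≠ 0 := by simp [hω.ne']
    obtain ⟨t, ht, u, hu, h⟩ := hmem ω
    rw [← aeval_inv_reflect_mul_pow ha hz, ← aeval_inv_reflect_mul_pow hb hz,
      ← aeval_inv_reflect_mul_pow hc hz, ← aeval_inv_reflect_mul_pow hq hz, ← mul_assoc,
      ← mul_assoc, ← add_mul, ← add_mul] at h
    have h' := mul_right_cancel₀ (pow_ne_zero D hz) h
    have hrq : r q ω = r a ω + t * r b ω + u * r c ω := by
      simp only [hr, h']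
      simp
      ring
    rw [hrq]
    set m := min (min (r a ω) (r a ω + r b ω)) (min (r a ω + r c ω) (r a ω + r b ω + r c ω))
    have m1 : m ≤ r a ω := (min_le_left _ _).trans (min_le_left _ _)
    have m2 : m ≤ r a ω + r b ω := (min_le_left _ _).trans (min_le_right _ _)
    have m3 : m ≤ r a ω + r c ω := (min_le_right _ _).trans (min_le_left _ _)
    have m4 : m ≤ r a ω + r b ω + r c ω := (min_le_right _ _).trans (min_le_right _ _)
    have t0 := ht.1
    have t1 := sub_nonneg.2 ht.2
    have u0 := hu.1
    have u1 := sub_nonneg.2 hu.2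
    -- An affine function on the square is the average of its corner values with weights
    -- `(1-t)(1-u)`, `t(1-u)`, `(1-t)u`, `tu`.
    nlinarith [mul_le_mul_of_nonneg_left m1 (mul_nonneg t1 u1),
      mul_le_mul_of_nonneg_left m2 (mul_nonneg t0 u1),
      mul_le_mul_of_nonneg_left m3 (mul_nonneg t1 u0),
      mul_le_mul_of_nonneg_left m4 (mul_nonneg t0 u0)]
  have hl := (((hlim a).min ((hlim a).add (hlim b))).min
    (((hlim a).add (hlim c)).min (((hlim a).add (hlim b)).add (hlim c))))
  refine le_trans ?_ (le_of_tendsto_of_tendsto hl (hlim q) hlow)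
  simp only [← mul_add]
  simp [h00, h10, h01, h11]

/-- If the four corners of a parallelogram of real polynomials are Hurwitz and no element of it
vanishes on the imaginary axis, then every polynomial whose values on the imaginary axis are in
the parallelogram is Hurwitz. -/
lemma IsHurwitz.of_mem_parallelogram {a b c q : ℝ[X]}
    (hcor : ∀ t ∈ ({0, 1} : Finset ℝ), ∀ u ∈ ({0, 1} : Finset ℝ),
      IsHurwitz (a + C t * b + C u * c))
    (hax : ∀ t ∈ Set.Icc (0 : ℝ) 1, ∀ u ∈ Set.Icc (0 : ℝ) 1, ∀ ω : ℝ,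
      aeval (ω * Complex.I) a + t * aeval (ω * Complex.I) b +
        u * aeval (ω * Complex.I) c ≠ 0)
    (hmem : ∀ ω : ℝ, ∃ t ∈ Set.Icc (0 : ℝ) 1, ∃ u ∈ Set.Icc (0 : ℝ) 1,
      aeval (ω * Complex.I) q = aeval (ω * Complex.I) a + t * aeval (ω * Complex.I) b +
        u * aeval (ω * Complex.I) c) : IsHurwitz q := by
  set V : ℝ × ℝ → ℝ[X] := fun x => a + C x.1 * b + C x.2 * c with hV
  have hcorner : ∀ x ∈ ({0, 1} : Finset ℝ) ×ˢ ({0, 1} : Finset ℝ), IsHurwitz (V x) :=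
    fun x hx => hcor _ (Finset.mem_product.1 hx).1 _ (Finset.mem_product.1 hx).2
  have h01 : ∀ t ∈ ({0, 1} : Finset ℝ), t ∈ Set.Icc (0 : ℝ) 1 := by
    intro t ht
    simp only [Finset.mem_insert, Finset.mem_singleton] at ht
    rcases ht with rfl | rfl <;> simp
  obtain ⟨x₀, hx₀, hmax⟩ := Finset.exists_max_image
    (({0, 1} : Finset ℝ) ×ˢ ({0, 1} : Finset ℝ)) (fun x => (V x).natDegree) ⟨(0, 0), by simp⟩
  set N := (V x₀).natDegree with hN
  have hH₀ := hcorner x₀ hx₀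
  set ε := (V x₀).coeff 0 with hε
  have hε0 : ε ≠ 0 := fun h => by
    have := hH₀.leadingCoeff_mul_coeff_zero_pos
    rw [← hε, h, mul_zero] at this
    exact this.false
  have hpar : ∀ x : ℝ × ℝ, ∀ z : ℂ, aeval z (V x) = aeval z a + x.1 * aeval z b +
      x.2 * aeval z c := by
    intro x z; simp [hV]
  have hsign : ∀ x ∈ ({0, 1} : Finset ℝ) ×ˢ ({0, 1} : Finset ℝ), 0 < ε * (V x).coeff 0 := by
    intro x hx
    by_contra! hneg
    have hne := (hcorner x hx).leadingCoeff_mul_coeff_zero_pos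
    have hx0 : (V x).coeff 0 ≠ 0 := fun h => by simp [h] at hne
    set η := (V x).coeff 0 with hη
    have hden : ε - η ≠ 0 := fun h => by
      have : ε = η := by linarith
      rw [this] at hneg
      exact hx0 (by nlinarith)
    -- If the constant terms had opposite signs, this point of the segment between the two corners
    -- would vanish at `ω = 0`.
    set s := ε / (ε - η) with hs
    have hsq : 0 < (ε - η) ^ 2 := by positivity
    have hs0 : 0 ≤ s := by
      have : s = (ε * ε - ε * η) / (ε - η) ^ 2 := by rw [hs]; field_simp
      rw [this]
      exact div_nonneg (by nlinarith) hsq.le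
    have hs1 : 0 ≤ 1 - s := by
      have : 1 - s = (η * η - ε * η) / (ε - η) ^ 2 := by rw [hs]; field_simp; ring
      rw [this]
      exact div_nonneg (by nlinarith) hsq.le
    have hp := Finset.mem_product.1 hx
    have hp₀ := Finset.mem_product.1 hx₀
    have hconv := fun y₁ y₂ (h₁ : y₁ ∈ Set.Icc (0 : ℝ) 1) (h₂ : y₂ ∈ Set.Icc (0 : ℝ) 1) =>
      convex_Icc (0 : ℝ) 1 h₁ h₂ hs1 hs0 (by ring)
    refine hax _ (hconv _ _ (h01 _ hp₀.1) (h01 _ hp.1)) _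
      (hconv _ _ (h01 _ hp₀.2) (h01 _ hp.2)) 0 ?_
    have e0 : ∀ p : ℝ[X], aeval (((0 : ℝ) : ℂ) * Complex.I) p = (p.coeff 0 : ℂ) := by
      intro p; simp [aeval_def, eval₂_at_zero]
    have hz : (1 - s) * ε + s * η = 0 := by rw [hs]; field_simp; ring
    have e1 : ε = a.coeff 0 + x₀.1 * b.coeff 0 + x₀.2 * c.coeff 0 := by
      simp only [hε, hV, coeff_add, coeff_C_mul]
    have e2 : η = a.coeff 0 + x.1 * b.coeff 0 + x.2 * c.coeff 0 := by
      simp only [hη, hV, coeff_add, coeff_C_mul]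
    rw [e0, e0, e0]
    norm_cast
    rw [e1, e2] at hz
    simp only [smul_eq_mul]
    rw [← hz]
    ring
  have hlead : ∀ D, N ≤ D → ∀ x ∈ ({0, 1} : Finset ℝ) ×ˢ ({0, 1} : Finset ℝ),
      0 ≤ ε * (V x).coeff D := by
    intro D hD x hx
    rcases ((hmax x hx).trans hD).lt_or_eq with h | h
    · rw [coeff_eq_zero_of_natDegree_lt h, mul_zero]
    · have h1 := (hcorner x hx).leadingCoeff_mul_coeff_zero_pos
      have h2 := hsign x hx
      rw [leadingCoeff, show (V x).natDegree = D from h] at h1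
      by_contra! h3
      nlinarith [mul_pos h1 h2, sq_nonneg ((V x).coeff 0)]
  have hdeg00 : (V (0, 0)).natDegree ≤ N := hmax _ (by simp)
  have hdeg10 : (V (1, 0)).natDegree ≤ N := hmax _ (by simp)
  have hdeg01 : (V (0, 1)).natDegree ≤ N := hmax _ (by simp)
  have haN : a.natDegree ≤ N := by simpa [hV] using hdeg00
  have hbN : b.natDegree ≤ N := by
    have : b = V (1, 0) - V (0, 0) := by simp [hV]
    rw [this]
    exact (natDegree_sub_le _ _).trans (max_le hdeg10 hdeg00)
  have hcN : c.natDegree ≤ N := by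
    have : c = V (0, 1) - V (0, 0) := by simp [hV]
    rw [this]
    exact (natDegree_sub_le _ _).trans (max_le hdeg01 hdeg00)
  have hqD : ∀ D, N ≤ D → q.natDegree ≤ D → 0 ≤ ε * q.coeff D := by
    intro D hD hq
    have h := hlead D hD
    refine coeff_nonneg_of_mem_parallelogram (haN.trans hD) (hbN.trans hD) (hcN.trans hD) hq hmem ε
      ?_ ?_ ?_ ?_
    · simpa [hV] using h (0, 0) (by simp)
    · simpa [hV] using h (1, 0) (by simp)
    · simpa [hV] using h (0, 1) (by simp)
    · simpa [hV] using h (1, 1) (by simp)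
  have hqN : q.natDegree ≤ N := by
    by_contra! hlt
    have h0 : ∀ p : ℝ[X], p.natDegree ≤ N → p.coeff q.natDegree = 0 := fun p hp =>
      coeff_eq_zero_of_natDegree_lt (hp.trans_lt hlt)
    -- Above degree `N` all corner coefficients vanish, so the sign lemma applies with both `ε` and
    -- `-ε`.
    have h2 : 0 ≤ -ε * q.coeff q.natDegree :=
      coeff_nonneg_of_mem_parallelogram (haN.trans hlt.le) (hbN.trans hlt.le) (hcN.trans hlt.le)
        le_rfl hmem (-ε) (by simp [h0 a haN]) (by simp [h0 a haN, h0 b hbN])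
        (by simp [h0 a haN, h0 c hcN]) (by simp [h0 a haN, h0 b hbN, h0 c hcN])
    have h3 : ε * q.coeff q.natDegree = 0 := by
      have h1 := hqD _ hlt.le le_rfl
      linarith
    have h4 : q = 0 := by simpa [hε0] using h3
    rw [h4, natDegree_zero] at hlt
    exact absurd hlt (Nat.not_lt_zero _)
  have hVpos : 0 < ε * (V x₀).coeff N := by
    have h := hH₀.leadingCoeff_mul_coeff_zero_pos
    rwa [leadingCoeff, mul_comm] at h
  -- The segment runs from a corner of maximal degree to `q`. Its coefficient of order `N` keeps the
  -- sign of `ε` before the end point, and on the axis its values stay in the convex parallelogram.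
  refine hH₀.of_segment (N := N) le_rfl hqN ?_ ?_
  · intro s hs h
    have h1 : (1 - s) * (ε * (V x₀).coeff N) + s * (ε * q.coeff N) = 0 := by
      linear_combination ε * h
    have h2 := mul_pos (sub_pos.2 hs.2) hVpos
    have h3 := mul_nonneg hs.1 (hqD N le_rfl hqN)
    linarith
  · intro s hs ω h
    obtain ⟨t, ht, u, hu, hq⟩ := hmem ω
    have hp₀ := Finset.mem_product.1 hx₀
    have hs1 := sub_nonneg.2 hs.2
    refine hax _ (convex_Icc (0 : ℝ) 1 (h01 _ hp₀.1) ht hs1 hs.1 (by ring)) _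
      (convex_Icc (0 : ℝ) 1 (h01 _ hp₀.2) hu hs1 hs.1 (by ring)) ω ?_
    rw [hq, hpar] at h
    rw [← h]
    push_cast [smul_eq_mul]
    ring

/-! ### The edge theorem for parallelograms. -/

/-- A line through an interior point of the unit square meets the boundary of the square. -/
lemma exists_mem_square_boundary {t u α β : ℝ} (ht : t ∈ Set.Icc (0 : ℝ) 1)
    (hu : u ∈ Set.Icc (0 : ℝ) 1) (h : α ≠ 0 ∨ β ≠ 0) :
    ∃ s : ℝ, t + s * α ∈ Set.Icc (0 : ℝ) 1 ∧ u + s * β ∈ Set.Icc (0 : ℝ) 1 ∧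
      (t + s * α = 0 ∨ t + s * α = 1 ∨ u + s * β = 0 ∨ u + s * β = 1) := by
  -- `g` is the sup norm after rescaling the square to `[-1, 1]²`; its level `1` is the boundary,
  -- reached by the intermediate value theorem.
  set g : ℝ → ℝ := fun s => max |2 * (t + s * α) - 1| |2 * (u + s * β) - 1| with hg
  have hgc : Continuous g := by fun_prop
  have h0 : g 0 ≤ 1 := by
    simp only [hg, zero_mul, add_zero]
    exact max_le (abs_le.2 ⟨by linarith [ht.1], by linarith [ht.2]⟩)
      (abs_le.2 ⟨by linarith [hu.1], by linarith [hu.2]⟩)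
  have h1 : ∃ s, 1 ≤ g s := by
    rcases h with h | h
    · refine ⟨1 / α, le_trans ?_ (le_max_left _ _)⟩
      rw [one_div_mul_cancel h]
      exact (by linarith [ht.1] : 1 ≤ 2 * (t + 1) - 1).trans (le_abs_self _)
    · refine ⟨1 / β, le_trans ?_ (le_max_right _ _)⟩
      rw [one_div_mul_cancel h]
      exact (by linarith [hu.1] : 1 ≤ 2 * (u + 1) - 1).trans (le_abs_self _)
  obtain ⟨s₁, hs₁⟩ := h1
  obtain ⟨s, hs⟩ := mem_range_of_exists_le_of_exists_ge hgc ⟨0, h0⟩ ⟨s₁, hs₁⟩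
  have a1 := abs_le.1 ((le_max_left _ _).trans hs.le)
  have a2 := abs_le.1 ((le_max_right _ _).trans hs.le)
  refine ⟨s, ⟨by linarith [a1.1], by linarith [a1.2]⟩, ⟨by linarith [a2.1], by linarith [a2.2]⟩, ?_⟩
  rcases max_choice |2 * (t + s * α) - 1| |2 * (u + s * β) - 1| with hm | hm
  · rcases eq_or_eq_neg_of_abs_eq (hm.symm.trans hs) with e | e
    · exact Or.inr (Or.inl (by linarith))
    · exact Or.inl (by linarith)
  · rcases eq_or_eq_neg_of_abs_eq (hm.symm.trans hs) with e | e
    · exact Or.inr (Or.inr (Or.inr (by linarith)))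
    · exact Or.inr (Or.inr (Or.inl (by linarith)))

/-- A continuously moving parallelogram in the plane that starts out degenerate and whose edges
avoid the origin avoids the origin. -/
lemma parallelogram_ne_zero {a b c : ℝ → ℂ} (ha : Continuous a) (hb : Continuous b)
    (hc : Continuous c) (hdeg : (b 0).re * (c 0).im - (b 0).im * (c 0).re = 0)
    (hbd : ∀ ω : ℝ, ∀ t ∈ Set.Icc (0 : ℝ) 1, ∀ u ∈ Set.Icc (0 : ℝ) 1,
      (t = 0 ∨ t = 1 ∨ u = 0 ∨ u = 1) → a ω + t * b ω + u * c ω ≠ 0) :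
    ∀ ω : ℝ, ∀ t ∈ Set.Icc (0 : ℝ) 1, ∀ u ∈ Set.Icc (0 : ℝ) 1,
      a ω + t * b ω + u * c ω ≠ 0 := by
  -- Where the parallelogram is degenerate, sliding along a linear relation between `b ω` and `c ω`
  -- keeps the value and reaches an edge.
  have hdep : ∀ ω, (b ω).re * (c ω).im - (b ω).im * (c ω).re = 0 →
      ∀ t ∈ Set.Icc (0 : ℝ) 1, ∀ u ∈ Set.Icc (0 : ℝ) 1, a ω + t * b ω + u * c ω ≠ 0 := by
    intro ω hω t ht u hu hz
    obtain ⟨α, β, hne, hαβ⟩ : ∃ α β : ℝ, (α ≠ 0 ∨ β ≠ 0) ∧ α * b ω + β * c ω = 0 := by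
      by_cases h1 : (c ω).re = 0 ∧ (b ω).re = 0
      · by_cases h2 : (c ω).im = 0 ∧ (b ω).im = 0
        · refine ⟨1, 0, by simp, ?_⟩
          apply Complex.ext <;> simp [h1, h2]
        · refine ⟨(c ω).im, -(b ω).im, by simpa [or_iff_not_imp_left] using h2, ?_⟩
          apply Complex.ext <;> simp [h1]
          ring
      · refine ⟨(c ω).re, -(b ω).re, by simpa [or_iff_not_imp_left] using h1, ?_⟩
        apply Complex.ext <;> simp <;> linarith
    obtain ⟨s, h1, h2, h3⟩ := exists_mem_square_boundary ht hu hne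
    refine hbd ω _ h1 _ h2 h3 ?_
    rw [← hz]
    push_cast
    linear_combination (s : ℂ) * hαβ
  -- `Z` collects the `ω` at which the origin is hit. It is clopen in `ℝ` and misses `0`, hence is
  -- empty.
  set Z : Set ℝ := Prod.snd '' {x : (unitInterval × unitInterval) × ℝ |
    a x.2 + ((x.1.1 : ℝ) : ℂ) * b x.2 + ((x.1.2 : ℝ) : ℂ) * c x.2 = 0} with hZ
  have hmemZ : ∀ ω, ω ∈ Z ↔ ∃ t ∈ Set.Icc (0 : ℝ) 1, ∃ u ∈ Set.Icc (0 : ℝ) 1,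
      a ω + t * b ω + u * c ω = 0 := by
    intro ω
    constructor
    · rintro ⟨⟨⟨t, u⟩, ω'⟩, h, rfl⟩
      exact ⟨t, t.2, u, u.2, h⟩
    · rintro ⟨t, ht, u, hu, h⟩
      exact ⟨⟨⟨⟨t, ht⟩, ⟨u, hu⟩⟩, ω⟩, h, rfl⟩
  have hclosed : IsClosed Z := by
    apply isClosedMap_snd_of_compactSpace
    exact isClosed_eq (by fun_prop) continuous_const
  have hopen : IsOpen Z := by
    rw [isOpen_iff_mem_nhds]
    intro ω₀ hω₀
    obtain ⟨t, ht, u, hu, hz⟩ := (hmemZ ω₀).1 hω₀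
    set Δ : ℝ → ℝ := fun ω => (b ω).re * (c ω).im - (b ω).im * (c ω).re with hΔ
    have hΔ0 : Δ ω₀ ≠ 0 := fun h => hdep ω₀ h t ht u hu hz
    have hnb : ¬(t = 0 ∨ t = 1 ∨ u = 0 ∨ u = 1) := fun h => hbd ω₀ t ht u hu h hz
    push Not at hnb
    have hre := congrArg Complex.re hz
    have him := congrArg Complex.im hz
    simp at hre him
    have hcr := Complex.continuous_re
    have hci := Complex.continuous_im
    -- Cramer's rule: near `ω₀` the origin has continuous coordinates `(T, U)`, which stay inside
    -- the open square.
    set T : ℝ → ℝ := fun ω => ((a ω).im * (c ω).re - (a ω).re * (c ω).im) / Δ ω with hT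
    set U : ℝ → ℝ := fun ω => ((b ω).im * (a ω).re - (b ω).re * (a ω).im) / Δ ω with hU
    have hΔc : Continuous Δ := by fun_prop
    have hTc : ContinuousAt T ω₀ :=
      ContinuousAt.div (by fun_prop) hΔc.continuousAt hΔ0
    have hUc : ContinuousAt U ω₀ :=
      ContinuousAt.div (by fun_prop) hΔc.continuousAt hΔ0
    have hT0 : T ω₀ = t := by
      rw [hT]; simp only []
      rw [div_eq_iff hΔ0, hΔ]
      linear_combination (c ω₀).re * him - (c ω₀).im * hre
    have hU0 : U ω₀ = u := by
      rw [hU]; simp only []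
      rw [div_eq_iff hΔ0, hΔ]
      linear_combination (b ω₀).im * hre - (b ω₀).re * him
    have hTm : ∀ᶠ ω in nhds ω₀, T ω ∈ Set.Ioo (0 : ℝ) 1 :=
      hTc.eventually_mem (Ioo_mem_nhds (by rw [hT0]; exact lt_of_le_of_ne ht.1 hnb.1.symm)
        (by rw [hT0]; exact lt_of_le_of_ne ht.2 hnb.2.1))
    have hUm : ∀ᶠ ω in nhds ω₀, U ω ∈ Set.Ioo (0 : ℝ) 1 :=
      hUc.eventually_mem (Ioo_mem_nhds (by rw [hU0]; exact lt_of_le_of_ne hu.1 hnb.2.2.1.symm)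
        (by rw [hU0]; exact lt_of_le_of_ne hu.2 hnb.2.2.2))
    filter_upwards [hTm, hUm, hΔc.continuousAt.eventually_ne hΔ0] with ω h1 h2 h3
    refine (hmemZ ω).2 ⟨_, Set.Ioo_subset_Icc_self h1, _, Set.Ioo_subset_Icc_self h2, ?_⟩
    apply Complex.ext
    · simp [hT, hU]
      field_simp
      simp only [hΔ]
      ring
    · simp [hT, hU]
      field_simp
      simp only [hΔ]
      ring
  have hemp : Z = ∅ := by
    rcases isClopen_iff.1 ⟨hclosed, hopen⟩ with h | h
    · exact h
    · obtain ⟨t, ht, u, hu, hz⟩ := (hmemZ 0).1 (h ▸ Set.mem_univ 0)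
      exact (hdep 0 hdeg t ht u hu hz).elim
  intro ω t ht u hu hz
  have : ω ∈ Z := (hmemZ ω).2 ⟨t, ht, u, hu, hz⟩
  simp [hemp] at this

/-- A parallelogram of real polynomials is Hurwitz if its edges are. -/
lemma IsHurwitz.parallelogram {a b c : ℝ[X]}
    (hbd : ∀ t ∈ Set.Icc (0 : ℝ) 1, ∀ u ∈ Set.Icc (0 : ℝ) 1,
      (t = 0 ∨ t = 1 ∨ u = 0 ∨ u = 1) → IsHurwitz (a + C t * b + C u * c))
    {t u : ℝ} (ht : t ∈ Set.Icc (0 : ℝ) 1) (hu : u ∈ Set.Icc (0 : ℝ) 1) :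
    IsHurwitz (a + C t * b + C u * c) := by
  have hax := parallelogram_ne_zero (a := fun ω => aeval (ω * Complex.I) a)
    (b := fun ω => aeval (ω * Complex.I) b) (c := fun ω => aeval (ω * Complex.I) c)
    (by fun_prop) (by fun_prop) (by fun_prop)
    (by simp [aeval_def, eval₂_at_zero])
    (fun ω t ht u hu h => by
      have := (hbd t ht u hu h).aeval_ne_zero (z := ω * Complex.I) (by simp)
      simpa using this)
  refine IsHurwitz.of_mem_parallelogram (a := a) (b := b) (c := c) ?_
    (fun t ht u hu ω => hax ω t ht u hu) (fun ω => ⟨t, ht, u, hu, by simp⟩)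
  intro t ht u hu
  simp only [Finset.mem_insert, Finset.mem_singleton] at ht hu
  refine hbd t ?_ u ?_ (by tauto)
  · rcases ht with rfl | rfl <;> simp
  · rcases hu with rfl | rfl <;> simp

/-! ### The Kharitonov rectangle. -/

lemma polyOfCoeffs_add_mul_sub_add_mul_sub (d : ℕ) (q r w : ℕ → ℝ) (t u : ℝ) :
    polyOfCoeffs d q + C t * (polyOfCoeffs d r - polyOfCoeffs d q) +
      C u * (polyOfCoeffs d w - polyOfCoeffs d q) =
    polyOfCoeffs d fun l => q l + t * (r l - q l) + u * (w l - q l) := by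
  simp only [polyOfCoeffs, ← Finset.sum_sub_distrib, Finset.mul_sum, ← Finset.sum_add_distrib]
  refine Finset.sum_congr rfl fun l _ => ?_
  simp only [map_add, map_sub, map_mul]
  ring

/-- The polynomial `k₁ + t (k₃ - k₁) + u (k₂ - k₁)`, where `k₁`, `k₂`, `k₃` are the first three
Kharitonov polynomials; `t` moves the even part and `u` the odd part. -/
noncomputable def kharitonovParam (d : ℕ) (lo hi : ℕ → ℝ) (t u : ℝ) : ℝ[X] :=
  kharitonov1 d lo hi + C t * (kharitonov3 d lo hi - kharitonov1 d lo hi) +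
    C u * (kharitonov2 d lo hi - kharitonov1 d lo hi)

/-- Even coefficients agree in the pairs 1, 2 and 3, 4, odd ones in 1, 3 and 2, 4, so the four
polynomials are the corners of a parallelogram. -/
lemma kharitonov4_eq (d : ℕ) (lo hi : ℕ → ℝ) :
    kharitonov4 d lo hi = kharitonov3 d lo hi + kharitonov2 d lo hi - kharitonov1 d lo hi := by
  simp only [kharitonov1, kharitonov2, kharitonov3, kharitonov4, polyOfCoeffs,
    ← Finset.sum_sub_distrib, ← Finset.sum_add_distrib]
  refine Finset.sum_congr rfl fun l _ => ?_
  have : l % 4 < 4 := Nat.mod_lt _ (by norm_num)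
  interval_cases l % 4 <;> simp

lemma kharitonovParam_mem_intervalPoly {d : ℕ} {lo hi : ℕ → ℝ} (hle : ∀ l ≤ d, lo l ≤ hi l)
    {t u : ℝ} (ht : t ∈ Set.Icc (0 : ℝ) 1) (hu : u ∈ Set.Icc (0 : ℝ) 1) :
    kharitonovParam d lo hi t u ∈ intervalPoly d lo hi := by
  refine ⟨_, fun l hl => ?_, polyOfCoeffs_add_mul_sub_add_mul_sub ..⟩
  have h := hle l hl
  have t0 := ht.1
  have t1 := ht.2
  have u0 := hu.1
  have u1 := hu.2
  have : l % 4 < 4 := Nat.mod_lt _ (by norm_num)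
  interval_cases l % 4 <;> simp <;> constructor <;> nlinarith

lemma kharitonovParam_mem_kharitonovEdges {d : ℕ} {lo hi : ℕ → ℝ} {t u : ℝ}
    (ht : t ∈ Set.Icc (0 : ℝ) 1) (hu : u ∈ Set.Icc (0 : ℝ) 1)
    (h : (t = 0 ∨ t = 1) ∨ u = 0 ∨ u = 1) :
    kharitonovParam d lo hi t u ∈ kharitonovEdges d lo hi := by
  have ht' : 1 - t ∈ Set.Icc (0 : ℝ) 1 := ⟨by linarith [ht.2], by linarith [ht.1]⟩
  have hu' : 1 - u ∈ Set.Icc (0 : ℝ) 1 := ⟨by linarith [hu.2], by linarith [hu.1]⟩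
  rcases h with (rfl | rfl) | rfl | rfl
  · refine Or.inl (Or.inl (Or.inl ⟨1 - u, hu', ?_⟩))
    simp only [kharitonovParam, map_sub, map_one, map_zero]
    ring
  · refine Or.inl (Or.inr ⟨u, hu, ?_⟩)
    simp only [kharitonovParam, kharitonov4_eq, map_sub, map_one]
    ring
  · refine Or.inr ⟨t, ht, ?_⟩
    simp only [kharitonovParam, map_sub, map_one, map_zero]
    ring
  · refine Or.inl (Or.inl (Or.inr ⟨1 - t, ht', ?_⟩))
    simp only [kharitonovParam, kharitonov4_eq, map_sub, map_one]
    ring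

lemma kharitonovParam_mem_kharitonovVertices {d : ℕ} {lo hi : ℕ → ℝ} {t u : ℝ}
    (ht : t = 0 ∨ t = 1) (hu : u = 0 ∨ u = 1) :
    kharitonovParam d lo hi t u ∈ kharitonovVertices d lo hi := by
  rcases ht with rfl | rfl <;> rcases hu with rfl | rfl <;>
    simp only [kharitonovParam, kharitonovVertices, kharitonov4_eq, Set.mem_insert_iff,
      Set.mem_singleton_iff, map_one, map_zero]
  · exact Or.inl (by ring)
  · exact Or.inr (Or.inl (by ring))
  · exact Or.inr (Or.inr (Or.inl (by ring)))
  · exact Or.inr (Or.inr (Or.inr (by ring)))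

lemma exists_kharitonovParam_of_mem_kharitonovEdges {d : ℕ} {lo hi : ℕ → ℝ} {p : ℝ[X]}
    (hp : p ∈ kharitonovEdges d lo hi) :
    ∃ t ∈ Set.Icc (0 : ℝ) 1, ∃ u ∈ Set.Icc (0 : ℝ) 1, p = kharitonovParam d lo hi t u := by
  have h0 : (0 : ℝ) ∈ Set.Icc (0 : ℝ) 1 := by simp
  have h1 : (1 : ℝ) ∈ Set.Icc (0 : ℝ) 1 := by simp
  have hsub : ∀ x ∈ Set.Icc (0 : ℝ) 1, 1 - x ∈ Set.Icc (0 : ℝ) 1 := fun x hx =>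
    ⟨by linarith [hx.2], by linarith [hx.1]⟩
  rcases hp with ((⟨x, hx, rfl⟩ | ⟨x, hx, rfl⟩) | ⟨x, hx, rfl⟩) | ⟨x, hx, rfl⟩
  · refine ⟨0, h0, 1 - x, hsub x hx, ?_⟩
    simp only [kharitonovParam, map_sub, map_one, map_zero]
    ring
  · refine ⟨1 - x, hsub x hx, 1, h1, ?_⟩
    simp only [kharitonovParam, kharitonov4_eq, map_sub, map_one]
    ring
  · refine ⟨1, h1, x, hx, ?_⟩
    simp only [kharitonovParam, kharitonov4_eq, map_sub, map_one]
    ring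
  · refine ⟨x, hx, 0, h0, ?_⟩
    simp only [kharitonovParam, map_sub, map_one, map_zero]
    ring

lemma exists_kharitonovParam_of_mem_kharitonovVertices {d : ℕ} {lo hi : ℕ → ℝ} {p : ℝ[X]}
    (hp : p ∈ kharitonovVertices d lo hi) :
    ∃ t ∈ Set.Icc (0 : ℝ) 1, ∃ u ∈ Set.Icc (0 : ℝ) 1, p = kharitonovParam d lo hi t u := by
  have h0 : (0 : ℝ) ∈ Set.Icc (0 : ℝ) 1 := by simp
  have h1 : (1 : ℝ) ∈ Set.Icc (0 : ℝ) 1 := by simp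
  rcases hp with rfl | rfl | rfl | rfl
  · exact ⟨0, h0, 0, h0, by simp [kharitonovParam]⟩
  · exact ⟨0, h0, 1, h1, by simp [kharitonovParam]⟩
  · exact ⟨1, h1, 0, h0, by simp [kharitonovParam]⟩
  · refine ⟨1, h1, 1, h1, ?_⟩
    simp only [kharitonovParam, kharitonov4_eq, map_one]
    ring

lemma exists_eq_add_mul_of_le {x y e : ℝ} (h₁ : y ≤ x) (h₂ : x ≤ y + e) :
    ∃ t ∈ Set.Icc (0 : ℝ) 1, x = y + t * e := by
  rcases (show 0 ≤ e by linarith).eq_or_lt with rfl | he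
  · exact ⟨0, by simp, by linarith⟩
  · refine ⟨(x - y) / e, ⟨div_nonneg (by linarith) he.le, (div_le_one he).2 (by linarith)⟩, ?_⟩
    field_simp
    ring

lemma re_aeval_polyOfCoeffs (d : ℕ) (q : ℕ → ℝ) (ω : ℝ) :
    (aeval (ω * Complex.I) (polyOfCoeffs d q)).re =
      ∑ l ∈ Finset.range (d + 1), q l * (ω ^ l * (Complex.I ^ l).re) := by
  simp [polyOfCoeffs, mul_pow, ← Complex.ofReal_pow]

lemma im_aeval_polyOfCoeffs (d : ℕ) (q : ℕ → ℝ) (ω : ℝ) :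
    (aeval (ω * Complex.I) (polyOfCoeffs d q)).im =
      ∑ l ∈ Finset.range (d + 1), q l * (ω ^ l * (Complex.I ^ l).im) := by
  simp [polyOfCoeffs, mul_pow, ← Complex.ofReal_pow]

lemma re_I_pow (l : ℕ) : (Complex.I ^ l).re =
    if l % 4 = 0 then 1 else if l % 4 = 2 then -1 else 0 := by
  rw [Complex.I_pow_eq_pow_mod]
  have : l % 4 < 4 := Nat.mod_lt _ (by norm_num)
  interval_cases l % 4 <;> simp [Complex.I_pow_three]

lemma im_I_pow (l : ℕ) : (Complex.I ^ l).im =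
    if l % 4 = 1 then 1 else if l % 4 = 3 then -1 else 0 := by
  rw [Complex.I_pow_eq_pow_mod]
  have : l % 4 < 4 := Nat.mod_lt _ (by norm_num)
  interval_cases l % 4 <;> simp [Complex.I_pow_three]

lemma re_aeval_polyOfCoeffs_le {d : ℕ} {q r : ℕ → ℝ}
    (h : ∀ l ≤ d, q l * (Complex.I ^ l).re ≤ r l * (Complex.I ^ l).re) (ω : ℝ) :
    (aeval (ω * Complex.I) (polyOfCoeffs d q)).re ≤
      (aeval (ω * Complex.I) (polyOfCoeffs d r)).re := by
  rw [re_aeval_polyOfCoeffs, re_aeval_polyOfCoeffs]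
  refine Finset.sum_le_sum fun l hl => ?_
  have hl' := h l (Nat.lt_succ_iff.1 (Finset.mem_range.1 hl))
  rcases Nat.even_or_odd l with he | ho
  · nlinarith [mul_le_mul_of_nonneg_left hl' (he.pow_nonneg ω)]
  · have : (Complex.I ^ l).re = 0 := by
      rw [re_I_pow, if_neg, if_neg] <;> rcases ho with ⟨k, rfl⟩ <;> omega
    simp [this]

/-- Only odd powers contribute; the extra factor `ω` makes them even, which avoids splitting on the
sign of `ω`. -/
lemma mul_im_aeval_polyOfCoeffs_le {d : ℕ} {q r : ℕ → ℝ}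
    (h : ∀ l ≤ d, q l * (Complex.I ^ l).im ≤ r l * (Complex.I ^ l).im) (ω : ℝ) :
    ω * (aeval (ω * Complex.I) (polyOfCoeffs d q)).im ≤
      ω * (aeval (ω * Complex.I) (polyOfCoeffs d r)).im := by
  rw [im_aeval_polyOfCoeffs, im_aeval_polyOfCoeffs, Finset.mul_sum, Finset.mul_sum]
  refine Finset.sum_le_sum fun l hl => ?_
  have hl' := h l (Nat.lt_succ_iff.1 (Finset.mem_range.1 hl))
  rcases Nat.even_or_odd l with he | ho
  · have : (Complex.I ^ l).im = 0 := by
      rw [im_I_pow, if_neg, if_neg] <;> rcases he with ⟨k, rfl⟩ <;> omega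
    simp [this]
  · have hpow : 0 ≤ ω * ω ^ l := by
      rw [← pow_succ']
      exact ho.add_one.pow_nonneg ω
    nlinarith [mul_le_mul_of_nonneg_left hl' hpow]

/-- On the imaginary axis, the values of an interval polynomial lie in the Kharitonov
rectangle. -/
lemma exists_aeval_eq_kharitonovParam {d : ℕ} {lo hi : ℕ → ℝ} {p : ℝ[X]}
    (hp : p ∈ intervalPoly d lo hi) (ω : ℝ) :
    ∃ t ∈ Set.Icc (0 : ℝ) 1, ∃ u ∈ Set.Icc (0 : ℝ) 1,
      aeval (ω * Complex.I) p = aeval (ω * Complex.I) (kharitonovParam d lo hi t u) := by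
  obtain ⟨q, hq, rfl⟩ := hp
  have hmod : ∀ l, l % 4 < 4 := fun l => Nat.mod_lt _ (by norm_num)
  have hre1 : (aeval (ω * Complex.I) (kharitonov1 d lo hi)).re ≤
      (aeval (ω * Complex.I) (polyOfCoeffs d q)).re := by
    refine re_aeval_polyOfCoeffs_le (fun l hl => ?_) ω
    obtain ⟨h1, h2⟩ := hq l hl
    have := hmod l
    rw [re_I_pow]
    interval_cases l % 4 <;> simp <;> assumption
  have hre3 : (aeval (ω * Complex.I) (polyOfCoeffs d q)).re ≤
      (aeval (ω * Complex.I) (kharitonov3 d lo hi)).re := by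
    refine re_aeval_polyOfCoeffs_le (fun l hl => ?_) ω
    obtain ⟨h1, h2⟩ := hq l hl
    have := hmod l
    rw [re_I_pow]
    interval_cases l % 4 <;> simp <;> assumption
  have him1 : ω * (aeval (ω * Complex.I) (kharitonov1 d lo hi)).im ≤
      ω * (aeval (ω * Complex.I) (polyOfCoeffs d q)).im := by
    refine mul_im_aeval_polyOfCoeffs_le (fun l hl => ?_) ω
    obtain ⟨h1, h2⟩ := hq l hl
    have := hmod l
    rw [im_I_pow]
    interval_cases l % 4 <;> simp <;> assumption
  have him2 : ω * (aeval (ω * Complex.I) (polyOfCoeffs d q)).im ≤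
      ω * (aeval (ω * Complex.I) (kharitonov2 d lo hi)).im := by
    refine mul_im_aeval_polyOfCoeffs_le (fun l hl => ?_) ω
    obtain ⟨h1, h2⟩ := hq l hl
    have := hmod l
    rw [im_I_pow]
    interval_cases l % 4 <;> simp <;> assumption
  have hre2 : (aeval (ω * Complex.I) (kharitonov2 d lo hi)).re =
      (aeval (ω * Complex.I) (kharitonov1 d lo hi)).re := by
    rw [kharitonov1, kharitonov2, re_aeval_polyOfCoeffs, re_aeval_polyOfCoeffs]
    refine Finset.sum_congr rfl fun l _ => ?_
    have := hmod l
    rw [re_I_pow]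
    interval_cases l % 4 <;> simp
  have him3 : (aeval (ω * Complex.I) (kharitonov3 d lo hi)).im =
      (aeval (ω * Complex.I) (kharitonov1 d lo hi)).im := by
    rw [kharitonov1, kharitonov3, im_aeval_polyOfCoeffs, im_aeval_polyOfCoeffs]
    refine Finset.sum_congr rfl fun l _ => ?_
    have := hmod l
    rw [im_I_pow]
    interval_cases l % 4 <;> simp
  obtain ⟨t, ht, hte⟩ := exists_eq_add_mul_of_le hre1
    (hre3.trans_eq (add_sub_cancel _ _).symm)
  obtain ⟨u, hu, hue⟩ := exists_eq_add_mul_of_le him1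
    (him2.trans_eq (add_sub_cancel _ _).symm)
  refine ⟨t, ht, u, hu, ?_⟩
  have him : (aeval (ω * Complex.I) (polyOfCoeffs d q)).im =
      (aeval (ω * Complex.I) (kharitonov1 d lo hi)).im +
      u * ((aeval (ω * Complex.I) (kharitonov2 d lo hi)).im -
        (aeval (ω * Complex.I) (kharitonov1 d lo hi)).im) := by
    -- At `ω = 0` all imaginary parts vanish, so any `u` serves; otherwise `ω` cancels.
    rcases eq_or_ne ω 0 with rfl | hω
    · have h0 : ∀ p : ℝ[X], (aeval (((0 : ℝ) : ℂ) * Complex.I) p).im = 0 := by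
        intro p; simp [aeval_def, eval₂_at_zero]
      simp only [h0]
      ring
    · apply mul_left_cancel₀ hω
      linear_combination hue
  apply Complex.ext
  · rw [hte]
    simp [kharitonovParam, hre2]
  · rw [him]
    simp [kharitonovParam, him3]

/-! ### Determinants as functions of the parameters. -/

/-- The determinant is jointly affine in two entries of the same row. -/
lemma exists_det_add_single_row {m R : Type*} [Fintype m] [DecidableEq m] [CommRing R]
    (M : Matrix m m R) (i j₁ j₂ : m) (x y : R) :
    ∃ b c : R, ∀ t u : R,
      (M + Matrix.single i j₁ (t * x) + Matrix.single i j₂ (u * y)).det =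
        M.det + t * b + u * c := by
  refine ⟨(M.updateRow i (Pi.single j₁ x)).det, (M.updateRow i (Pi.single j₂ y)).det,
    fun t u => ?_⟩
  have h : M + Matrix.single i j₁ (t * x) + Matrix.single i j₂ (u * y) =
      M.updateRow i (M i + t • Pi.single j₁ x + u • Pi.single j₂ y) := by
    ext a b
    rcases eq_or_ne a i with rfl | ha
    · simp [Matrix.single_apply, Pi.single_apply, eq_comm]
    · simp [Matrix.updateRow_ne ha, ha.symm]
  rw [h, Matrix.det_updateRow_add, Matrix.det_updateRow_add, Matrix.det_updateRow_smul,
    Matrix.det_updateRow_smul, Matrix.updateRow_eq_self]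

/-- The determinant is jointly affine in two entries of the same row or the same column. -/
lemma exists_det_add_single {m R : Type*} [Fintype m] [DecidableEq m] [CommRing R]
    (M : Matrix m m R) {i₁ j₁ i₂ j₂ : m} (h : i₁ = i₂ ∨ j₁ = j₂) (x y : R) :
    ∃ b c : R, ∀ t u : R,
      (M + Matrix.single i₁ j₁ (t * x) + Matrix.single i₂ j₂ (u * y)).det =
        M.det + t * b + u * c := by
  rcases h with rfl | rfl
  · exact exists_det_add_single_row M i₁ j₁ j₂ x y
  · obtain ⟨b, c, h⟩ := exists_det_add_single_row M.transpose j₁ i₁ i₂ x y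
    refine ⟨b, c, fun t u => ?_⟩
    rw [← M.det_transpose, ← h, ← Matrix.det_transpose]
    simp [Matrix.transpose_add]

/-- The polynomial matrix with entries `A i j + τ (i, j, false) D i j false +
τ (i, j, true) D i j true`. -/
noncomputable def paramMatrix {m : Type*} (A : m → m → ℝ[X]) (D : m → m → Bool → ℝ[X])
    (τ : m × m × Bool → ℝ) : Matrix m m ℝ[X] :=
  Matrix.of fun i j => A i j + C (τ (i, j, false)) * D i j false + C (τ (i, j, true)) * D i j true

lemma paramMatrix_update {m : Type*} [DecidableEq m] (A : m → m → ℝ[X])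
    (D : m → m → Bool → ℝ[X]) (τ : m × m × Bool → ℝ) (k : m × m × Bool) (t : ℝ) :
    paramMatrix A D (Function.update τ k t) =
      paramMatrix A D τ + Matrix.single k.1 k.2.1 (C (t - τ k) * D k.1 k.2.1 k.2.2) := by
  obtain ⟨i, j, b⟩ := k
  ext1 i' j'
  by_cases h : i = i' ∧ j = j'
  · obtain ⟨rfl, rfl⟩ := h
    cases b <;> simp [paramMatrix] <;> ring
  · have h' : ∀ b', (i', j', b') ≠ (i, j, b) := by
      rintro b' he
      simp only [Prod.mk.injEq] at he
      exact h ⟨he.1.symm, he.2.1.symm⟩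
    rw [Matrix.add_apply, Matrix.single_apply, if_neg h, add_zero]
    simp [paramMatrix, Function.update_of_ne (h' _)]

/-- There is no `t * u` term because each product in the determinant uses one entry per row and
column. The two parameters may belong to the same entry. -/
lemma exists_det_paramMatrix_update {m : Type*} [Fintype m] [DecidableEq m]
    (A : m → m → ℝ[X]) (D : m → m → Bool → ℝ[X]) (τ : m × m × Bool → ℝ) {k l : m × m × Bool}
    (hkl : k ≠ l) (h : k.1 = l.1 ∨ k.2.1 = l.2.1) :
    ∃ a b c : ℝ[X], ∀ t u : ℝ,
      (paramMatrix A D (Function.update (Function.update τ k t) l u)).det =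
        a + C t * b + C u * c := by
  obtain ⟨b, c, hbc⟩ := exists_det_add_single
    (paramMatrix A D (Function.update (Function.update τ k 0) l 0)) h
    (D k.1 k.2.1 k.2.2) (D l.1 l.2.1 l.2.2)
  refine ⟨(paramMatrix A D (Function.update (Function.update τ k 0) l 0)).det, b, c,
    fun t u => ?_⟩
  rw [← hbc]
  congr 1
  simp only [paramMatrix_update, Function.update_of_ne hkl.symm, zero_sub, map_sub, map_neg]
  simp only [sub_eq_add_neg, add_mul, Matrix.single_add]
  abel

/-- If the determinants of all matrices `paramMatrix A D τ`, where `τ` has values in the unit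
interval and at most one value in each row and column is not an end point, are Hurwitz, then so
are all determinants with parameters in the unit interval. -/
lemma isHurwitz_det_paramMatrix {m : Type*} [Fintype m] [DecidableEq m]
    {A : m → m → ℝ[X]} {D : m → m → Bool → ℝ[X]}
    (h : ∀ τ : m × m × Bool → ℝ, (∀ k, τ k ∈ Set.Icc (0 : ℝ) 1) →
      (∀ k l, ¬(τ k = 0 ∨ τ k = 1) → ¬(τ l = 0 ∨ τ l = 1) → k.1 = l.1 ∨ k.2.1 = l.2.1 → k = l) →
      IsHurwitz (paramMatrix A D τ).det)
    (τ : m × m × Bool → ℝ) (hτ : ∀ k, τ k ∈ Set.Icc (0 : ℝ) 1) :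
    IsHurwitz (paramMatrix A D τ).det := by
  classical
  induction hN : (Finset.univ.filter fun k => ¬(τ k = 0 ∨ τ k = 1)).card using
    Nat.strong_induction_on generalizing τ with
  | _ N ih =>
    by_cases hc : ∀ k l, ¬(τ k = 0 ∨ τ k = 1) → ¬(τ l = 0 ∨ τ l = 1) →
        k.1 = l.1 ∨ k.2.1 = l.2.1 → k = l
    · exact h τ hτ hc
    push Not at hc
    obtain ⟨k, l, hk, hl, hrc, hne⟩ := hc
    obtain ⟨a, b, c, habc⟩ := exists_det_paramMatrix_update A D τ hne hrc
    have hself : τ = Function.update (Function.update τ k (τ k)) l (τ l) := by simp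
    rw [hself, habc]
    -- On an edge one of the two parameters becomes an end point, so the number of free parameters
    -- drops.
    refine IsHurwitz.parallelogram (fun t ht u hu htu => ?_) (hτ k) (hτ l)
    rw [← habc]
    refine ih _ ?_ _ ?_ rfl
    · rw [← hN]
      apply Finset.card_lt_card
      rw [Finset.ssubset_iff_of_subset]
      · rcases or_assoc.2 htu with ht' | hu'
        · refine ⟨k, by simpa using hk, ?_⟩
          simpa [Function.update_of_ne hne, or_iff_not_imp_left] using ht'
        · refine ⟨l, by simpa using hl, ?_⟩
          simpa [or_iff_not_imp_left] using hu'
      · intro x hx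
        simp only [Finset.mem_filter, Finset.mem_univ, true_and] at hx ⊢
        rcases eq_or_ne x l with rfl | hxl
        · simpa using hl
        rcases eq_or_ne x k with rfl | hxk
        · simpa using hk
        simpa [Function.update_of_ne hxl, Function.update_of_ne hxk] using hx
    · intro x
      rcases eq_or_ne x l with rfl | hxl
      · simpa using hu
      rcases eq_or_ne x k with rfl | hxk
      · simpa [Function.update_of_ne hxl] using ht
      simpa [Function.update_of_ne hxl, Function.update_of_ne hxk] using hτ x

/-! ### From Kharitonov rectangles to the whole family. -/

/-- Replacing the Kharitonov rectangle by the whole interval polynomial in a set of entries of a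
matrix preserves the Hurwitz property of the determinant. -/
lemma isHurwitz_det_of_forall_kharitonovParam {n : ℕ} {d : Fin n → Fin n → ℕ}
    {lo hi : Fin n → Fin n → ℕ → ℝ}
    (h : ∀ M : Matrix (Fin n) (Fin n) ℝ[X], (∀ i j, ∃ t ∈ Set.Icc (0 : ℝ) 1,
      ∃ u ∈ Set.Icc (0 : ℝ) 1, M i j = kharitonovParam (d i j) (lo i j) (hi i j) t u) →
      IsHurwitz M.det) (S : Finset (Fin n × Fin n)) :
    ∀ M : Matrix (Fin n) (Fin n) ℝ[X],
      (∀ i j, (i, j) ∈ S → M i j ∈ intervalPoly (d i j) (lo i j) (hi i j)) →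
      (∀ i j, (i, j) ∉ S → ∃ t ∈ Set.Icc (0 : ℝ) 1, ∃ u ∈ Set.Icc (0 : ℝ) 1,
        M i j = kharitonovParam (d i j) (lo i j) (hi i j) t u) →
      IsHurwitz M.det := by
  induction S using Finset.induction_on with
  | empty => exact fun M _ hM => h M fun i j => hM i j (by simp)
  | insert k S hk ih =>
    obtain ⟨i, j⟩ := k
    intro M hM hM'
    obtain ⟨b, c, hb⟩ := exists_det_add_single M (i₁ := i) (i₂ := i) (j₁ := j) (j₂ := j)
      (Or.inl rfl) 1 1
    have hdet : ∀ p, (M + Matrix.single i j (p - M i j)).det = M.det + (p - M i j) * b := by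
      intro p
      simpa using hb (p - M i j) 0
    have hparam : ∀ t ∈ Set.Icc (0 : ℝ) 1, ∀ u ∈ Set.Icc (0 : ℝ) 1,
        IsHurwitz (M.det + (kharitonovParam (d i j) (lo i j) (hi i j) t u - M i j) * b) := by
      intro t ht u hu
      rw [← hdet]
      apply ih
      · intro i' j' hS
        have hne : ¬(i = i' ∧ j = j') := by
          rintro ⟨rfl, rfl⟩
          exact hk hS
        rw [Matrix.add_apply, Matrix.single_apply, if_neg hne, add_zero]
        exact hM i' j' (Finset.mem_insert_of_mem hS)
      · intro i' j' hS
        by_cases he : i = i' ∧ j = j'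
        · obtain ⟨rfl, rfl⟩ := he
          exact ⟨t, ht, u, hu, by simp⟩
        · rw [Matrix.add_apply, Matrix.single_apply, if_neg he, add_zero]
          refine hM' i' j' fun hmem => ?_
          rcases Finset.mem_insert.1 hmem with h1 | h1
          · simp only [Prod.mk.injEq] at h1
            exact he ⟨h1.1.symm, h1.2.symm⟩
          · exact hS h1
    set k₁ := kharitonov1 (d i j) (lo i j) (hi i j) with hk₁
    set k₂ := kharitonov2 (d i j) (lo i j) (hi i j) with hk₂
    set k₃ := kharitonov3 (d i j) (lo i j) (hi i j) with hk₃
    have hpar : ∀ t u, M.det + (kharitonovParam (d i j) (lo i j) (hi i j) t u - M i j) * b =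
        (M.det + (k₁ - M i j) * b) + C t * ((k₃ - k₁) * b) + C u * ((k₂ - k₁) * b) := by
      intro t u
      simp only [kharitonovParam, ← hk₁, ← hk₂, ← hk₃]
      ring
    simp only [hpar] at hparam
    -- The determinant is affine in the entry `(i, j)`, so it maps the Kharitonov rectangle at `iω`
    -- onto a parallelogram containing the value of `M.det`.
    refine IsHurwitz.of_mem_parallelogram (a := M.det + (k₁ - M i j) * b) (b := (k₃ - k₁) * b)
      (c := (k₂ - k₁) * b) ?_ ?_ ?_
    · intro t ht u hu
      simp only [Finset.mem_insert, Finset.mem_singleton] at ht hu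
      refine hparam t ?_ u ?_
      · rcases ht with rfl | rfl <;> simp
      · rcases hu with rfl | rfl <;> simp
    · intro t ht u hu ω
      have := (hparam t ht u hu).aeval_ne_zero (z := ω * Complex.I) (by simp)
      rw [map_add, map_add, map_mul, map_mul (aeval _) (C u), aeval_C, aeval_C] at this
      exact this
    · intro ω
      obtain ⟨t, ht, u, hu, htu⟩ :=
        exists_aeval_eq_kharitonovParam (hM i j (Finset.mem_insert_self _ _)) ω
      refine ⟨t, ht, u, hu, ?_⟩
      have h1 := congrArg (aeval (ω * Complex.I)) (hpar t u)
      rw [map_add, map_mul, map_sub, ← htu, sub_self, zero_mul, add_zero] at h1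
      rw [h1, map_add, map_add, map_mul (aeval _) (C t), map_mul (aeval _) (C u), aeval_C, aeval_C]
      rfl

theorem theorem2 (n : ℕ) (d : Fin n → Fin n → ℕ) (lo hi : Fin n → Fin n → ℕ → ℝ)
    (hle : ∀ i j, ∀ l ≤ d i j, lo i j l ≤ hi i j l) :
    RobustlyHurwitzStable (intervalMatrixFamily d lo hi) ↔
      RobustlyHurwitzStable (kharitonovEdgeFamily d lo hi) := by
  constructor
  · intro hG M hM
    obtain ⟨σ, hσ⟩ := Set.mem_iUnion.1 hM
    refine hG M fun i j => ?_
    obtain ⟨t, ht, u, hu, h⟩ : ∃ t ∈ Set.Icc (0 : ℝ) 1, ∃ u ∈ Set.Icc (0 : ℝ) 1,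
        M i j = kharitonovParam (d i j) (lo i j) (hi i j) t u := by
      by_cases hij : i = σ j
      · exact exists_kharitonovParam_of_mem_kharitonovEdges ((hσ i j).1 hij)
      · exact exists_kharitonovParam_of_mem_kharitonovVertices ((hσ i j).2 hij)
    rw [h]
    exact kharitonovParam_mem_intervalPoly (hle i j) ht hu
  · intro hE M hM
    refine isHurwitz_det_of_forall_kharitonovParam (d := d) (lo := lo) (hi := hi) ?_ Finset.univ M
      (fun i j _ => hM i j) (fun i j hij => absurd (Finset.mem_univ _) hij)
    clear hM M
    intro M hM
    choose t ht u hu hM using hM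
    set A : Fin n → Fin n → ℝ[X] := fun i j => kharitonov1 (d i j) (lo i j) (hi i j) with hA
    set D : Fin n → Fin n → Bool → ℝ[X] := fun i j b => bif b
      then kharitonov2 (d i j) (lo i j) (hi i j) - kharitonov1 (d i j) (lo i j) (hi i j)
      else kharitonov3 (d i j) (lo i j) (hi i j) - kharitonov1 (d i j) (lo i j) (hi i j) with hD
    have hentry : ∀ τ i j, paramMatrix A D τ i j =
        kharitonovParam (d i j) (lo i j) (hi i j) (τ (i, j, false)) (τ (i, j, true)) :=
      fun τ i j => rfl
    have hMτ : M = paramMatrix A D fun k => bif k.2.2 then u k.1 k.2.1 else t k.1 k.2.1 := by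
      ext1 i j
      rw [hM, hentry]
      rfl
    rw [hMτ]
    refine isHurwitz_det_paramMatrix (fun τ hτ hτ' => ?_) _ ?_
    · refine hE _ (Set.mem_iUnion.2 ?_)
      classical
      -- `s` is the set of columns with a free parameter and `f` picks its row. No two free
      -- parameters share a row, so `f` is injective on `s` and extends to a permutation.
      set s : Finset (Fin n) := Finset.univ.filter fun j => ∃ i b,
        ¬(τ (i, j, b) = 0 ∨ τ (i, j, b) = 1) with hs
      have hs' : ∀ j ∈ s, ∃ i b, ¬(τ (i, j, b) = 0 ∨ τ (i, j, b) = 1) := fun j hj =>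
        (Finset.mem_filter.1 hj).2
      have hf : ∃ f : Fin n → Fin n, ∀ j ∈ s, ∃ b, ¬(τ (f j, j, b) = 0 ∨ τ (f j, j, b) = 1) := by
        refine ⟨fun j => if hj : j ∈ s then (hs' j hj).choose else j, fun j hj => ?_⟩
        simp only [hj, dif_pos]
        exact (hs' j hj).choose_spec
      obtain ⟨f, hf⟩ := hf
      have hinj : Set.InjOn f s := by
        intro j hj j' hj' hjj
        obtain ⟨b, hb⟩ := hf j hj
        obtain ⟨b', hb'⟩ := hf j' hj'
        have := hτ' _ _ hb hb' (Or.inl hjj)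
        simp only [Prod.mk.injEq] at this
        exact this.2.1
      obtain ⟨g, hg⟩ := Finset.exists_equiv_extend_of_card_eq (α := Fin n) (β := Fin n)
        (t := Finset.univ) (by simp) (Finset.subset_univ _) hinj
      refine ⟨g.trans (Equiv.subtypeUnivEquiv Finset.mem_univ),
        fun i j => ⟨fun _ => ?_, fun hij => ?_⟩⟩
      · rw [hentry]
        refine kharitonovParam_mem_kharitonovEdges (hτ _) (hτ _) ?_
        -- Two free parameters in one entry would share a row.
        by_contra! hcon
        have := hτ' (i, j, false) (i, j, true) (by tauto) (by tauto) (Or.inl rfl)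
        simp at this
      · rw [hentry]
        -- A free parameter in column `j` must sit in row `f j`, so entries off the permutation have
        -- none.
        have hbin : ∀ b, τ (i, j, b) = 0 ∨ τ (i, j, b) = 1 := by
          intro b
          by_contra hb
          have hj : j ∈ s := Finset.mem_filter.2 ⟨Finset.mem_univ _, i, b, hb⟩
          obtain ⟨b', hb'⟩ := hf j hj
          have := hτ' _ _ hb hb' (Or.inr rfl)
          simp only [Prod.mk.injEq] at this
          apply hij
          rw [this.1, ← hg j hj]
          rfl
        exact kharitonovParam_mem_kharitonovVertices (hbin _) (hbin _)
    · rintro ⟨i, j, b⟩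
      cases b
      · exact ht i j
      · exact hu i j
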